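/- Let $\mathbb D=\{z\in\mathbb C:|z|<1\}$, let $\mathcal S$ be the class of injective analytic functions $f$ on $\mathbb D$ with $f(0)=0$ and $f'(0)=1$, and write $f(z)=z+\sum_{n=2}^\infty a_nz^n$. Let $k=\sqrt2+1$ and $$\phi_0(z)=1+\frac zk\cdot\frac{k+z}{k-z}\qquad(z\in\mathbb D).$$ Let $\mathcal S^*_R=\mathcal S^*(\phi_0)$ be the class of all $f\in\mathcal S$ such that $zf'(z)/f(z)\prec\phi_0(z)$, that is, such that there is an analytic function $\omega:\mathbb D\to\mathbb D$ with $\omega(0)=0$ and $zf'(z)/f(z)=\phi_0(\omega(z))$ for all $z\in\mathbb D$ (the left-hand side being $1$ at $z=0$). Then for every $f\in\mathcal S^*_R$ and every $z$ with $|z|\le 1/3$, the series below converges and the Bohr inequality $$|z|+\sum_{n=2}^\infty|a_n|\,|z|^n\le d\bigl(f(0),\partial f(\mathbb D)\bigr)$$ holds, where $d$ is the Euclidean distance. Moreover, there is a function $h\in\mathcal S$ with $zh'(z)/h(z)=\phi_0(z)$ on $\mathbb D$, and for every such $h$ the limit $h(-1):=\lim_{r\to1^-}h(-r)$ exists, the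 equation $h(r)+h(-1)=0$ has a smallest root $r_f$ in $(0,1)$, and $r_f>1/3$. -/

import Mathlib

namespace Bohr

/-- The open unit disk of the complex plane. -/
def unitDisk : Set ℂ := Metric.ball 0 1

/-- The class `S` of univalent analytic functions on the unit disk, normalized by
`f 0 = 0` and `f' 0 = 1`. Only the values on the disk matter. -/
structure IsNormalizedUnivalent (f : ℂ → ℂ) : Prop where
  analytic : DifferentiableOn ℂ f unitDisk
  injective : Set.InjOn f unitDisk
  map_zero : f 0 = 0
  deriv_zero : deriv f 0 = 1

/-- `Subordinate p q`: there is an analytic `ω` from the disk to the disk with `ω 0 = 0` and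
`p z = q (ω z)` on the disk. -/
def Subordinate (p q : ℂ → ℂ) : Prop :=
  ∃ ω : ℂ → ℂ, DifferentiableOn ℂ ω unitDisk ∧ Set.MapsTo ω unitDisk unitDisk ∧ ω 0 = 0 ∧
    ∀ z ∈ unitDisk, p z = q (ω z)

/-- The function `z f'(z) / f(z)`, with its removable singularity at `0` filled in by the
value `1` (the limit there when `f 0 = 0` and `f' 0 = 1`). -/
noncomputable def starQuotient (f : ℂ → ℂ) (z : ℂ) : ℂ :=
  if z = 0 then 1 else z * deriv f z / f z

/-- The Ma-Minda starlike class `S*(φ)`. -/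
def starlikeClass (φ : ℂ → ℂ) : Set (ℂ → ℂ) :=
  {f | IsNormalizedUnivalent f ∧ Subordinate (starQuotient f) φ}

/-- `h` is the function in `S` with `z h'(z) / h(z) = φ(z)` on the disk. -/
def IsKoebeOf (φ h : ℂ → ℂ) : Prop :=
  IsNormalizedUnivalent h ∧ ∀ z ∈ unitDisk, starQuotient h z = φ z

/-- The rational function `1 + (z / k) ((k + z) / (k - z))` with `k = √2 + 1`. -/
noncomputable def phiR (z : ℂ) : ℂ :=
  1 + z / ((Real.sqrt 2 + 1 : ℝ) : ℂ) *
    ((((Real.sqrt 2 + 1 : ℝ) : ℂ) + z) / (((Real.sqrt 2 + 1 : ℝ) : ℂ) - z))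

/-- The class `S*_R`. -/
noncomputable def starlikeClassR : Set (ℂ → ℂ) := starlikeClass phiR

/-- The `n`-th Taylor coefficient of `f` at `0`. -/
noncomputable def taylorCoeff (f : ℂ → ℂ) (n : ℕ) : ℂ :=
  iteratedDeriv n f 0 / (n.factorial : ℂ)

/-- The Bohr inequality `r + ∑_{n ≥ 2} |a_n| r ^ n ≤ d(f(0), ∂ f(𝔻))`, together with the
convergence of its left-hand side. -/
def BohrInequality (f : ℂ → ℂ) (r : ℝ) : Prop :=
  Summable (fun n : ℕ => ‖taylorCoeff f (n + 2)‖ * r ^ (n + 2)) ∧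
    r + ∑' n : ℕ, ‖taylorCoeff f (n + 2)‖ * r ^ (n + 2) ≤
      Metric.infDist (f 0) (frontier (f '' unitDisk))

/-- `rf` is the smallest root in `(0, 1)` of `h(r) + h(-1) = 0`, where `h(-1)` is
the limit of `h(-r)` as `r` increases to `1`, which is required to exist. -/
def IsSmallestRoot (h : ℂ → ℂ) (rf : ℝ) : Prop :=
  ∃ L : ℂ, Filter.Tendsto (fun r : ℝ => h (-(r : ℂ))) (nhdsWithin 1 (Set.Iio 1)) (nhds L) ∧
    IsLeast {r : ℝ | 0 < r ∧ r < 1 ∧ h (r : ℂ) + L = 0} rf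

end Bohr

open Set Filter Topology

namespace Bohr

/-! Write `s = √2 - 1`, so that `s ^ 2 + 2 * s = 1`. This identity makes `x (1 + x) / (1 - x)` equal
to `1` at `x = s`, so the defect `p = z f' / f - 1` is bounded by `1` on the disk. Cauchy's estimate
and the recursion from `z f' = f (1 + p)` then give `|a_n| ≤ 1`
(`norm_taylorCoeff_le_of_isStarDefect`), so the Bohr sum is at most `r / (1 - r)`, which is at most
`1 / 2` for `r ≤ 1 / 3`. On the other side, integrating the bound on `p` along rays gives `|f z| ≥
|z| / 2` (`half_le_norm_dslope`), so the boundary of the image is at distance at least `1 / 2` from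
`0`. The two sides meet at `1 / 2`. The Koebe-type function is `z e ^ (-s z) / (1 - s z) ^ 2`, and
it is unique (`IsKoebeOf.eq_extremal`). On the real axis it stays below `1 / 2 ≤ -h(-1)` up to `1 /
3`, and it exceeds `1 ≥ -h(-1)` at `1`, so the smallest root lies beyond `1 / 3`. -/

/-- The number `√2 - 1 = 1 / (√2 + 1)`. -/
noncomputable def silver : ℝ := Real.sqrt 2 - 1

lemma silver_sq_add : silver ^ 2 + 2 * silver = 1 := by
  have := Real.sq_sqrt (show (0 : ℝ) ≤ 2 by norm_num)
  unfold silver; nlinarith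

lemma silver_pos : 0 < silver := by
  have := Real.lt_sqrt (x := 1) (y := 2) (by norm_num)
  unfold silver; linarith [this.2 (by norm_num)]

lemma silver_lt_half : silver < 1 / 2 := by
  nlinarith [silver_sq_add, silver_pos]

lemma two_fifths_lt_silver : 2 / 5 < silver := by
  nlinarith [silver_sq_add, silver_pos]

lemma phiR_eq (z : ℂ) :
    phiR z = 1 + silver * z * (1 + silver * z) / (1 - silver * z) := by
  have hs : (silver : ℂ) ≠ 0 := by exact_mod_cast silver_pos.ne'
  have hk : ((Real.sqrt 2 + 1 : ℝ) : ℂ) = (silver : ℂ)⁻¹ := by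
    rw [← Complex.ofReal_inv]
    congr 1
    refine eq_inv_of_mul_eq_one_left ?_
    have := Real.sq_sqrt (show (0 : ℝ) ≤ 2 by norm_num)
    unfold silver; nlinarith
  have h : ((silver : ℂ)⁻¹ + z) / ((silver : ℂ)⁻¹ - z) =
      (1 + silver * z) / (1 - silver * z) := by
    rw [← mul_div_mul_left _ _ hs, mul_add, mul_sub, mul_inv_cancel₀ hs]
  rw [phiR, hk, h, div_inv_eq_mul]
  ring

lemma mem_unitDisk {z : ℂ} : z ∈ unitDisk ↔ ‖z‖ < 1 := by simp [unitDisk]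

lemma isOpen_unitDisk : IsOpen unitDisk := Metric.isOpen_ball

lemma zero_mem_unitDisk : (0 : ℂ) ∈ unitDisk := by simp [unitDisk]

lemma norm_silver_mul (z : ℂ) : ‖(silver : ℂ) * z‖ = silver * ‖z‖ := by
  rw [norm_mul, Complex.norm_real, Real.norm_of_nonneg silver_pos.le]

lemma silver_mul_lt_half {r : ℝ} (h1 : r ≤ 1) : silver * r < 1 / 2 := by
  nlinarith [silver_lt_half, silver_pos]

lemma one_sub_silver_mul_ne_zero {z : ℂ} (hz : z ∈ unitDisk) : 1 - (silver : ℂ) * z ≠ 0 := by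
  intro h
  have h1 : ‖(silver : ℂ) * z‖ = 1 := by rw [← sub_eq_zero.1 h, norm_one]
  rw [norm_silver_mul] at h1
  linarith [silver_mul_lt_half (mem_unitDisk.1 hz).le]

/-- The majorant `x (1 + x) / (1 - x)` of `phiR - 1`, as a function of `x = (√2 - 1) |z|`. -/
noncomputable def majorant (x : ℝ) : ℝ := x * (1 + x) / (1 - x)

lemma majorant_mono {x y : ℝ} (hx : 0 ≤ x) (hxy : x ≤ y) (hy : y < 1) :
    majorant x ≤ majorant y := by
  unfold majorant
  exact div_le_div₀ (by nlinarith) (by nlinarith) (by linarith) (by linarith)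

/-- By monotonicity only `x = silver` matters, and there `silver ^ 2 + 2 * silver = 1` gives
equality. -/
lemma majorant_le_one {r : ℝ} (h0 : 0 ≤ r) (h1 : r ≤ 1) : majorant (silver * r) ≤ 1 := by
  have h : majorant (silver * r) ≤ majorant silver :=
    majorant_mono (mul_nonneg silver_pos.le h0) (by nlinarith [silver_pos])
      (by linarith [silver_lt_half])
  refine h.trans ?_
  rw [majorant, div_le_one (by linarith [silver_lt_half])]
  nlinarith [silver_sq_add]

lemma norm_phiR_sub_one_le {z : ℂ} (hz : z ∈ unitDisk) :
    ‖phiR z - 1‖ ≤ majorant (silver * ‖z‖) := by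
  have h1 := silver_mul_lt_half (mem_unitDisk.1 hz).le
  rw [phiR_eq, add_sub_cancel_left, norm_div, norm_mul, norm_silver_mul, majorant]
  have h2 := norm_add_le (1 : ℂ) (silver * z)
  have h3 := norm_sub_norm_le (1 : ℂ) (silver * z)
  rw [norm_one, norm_silver_mul] at h2 h3
  have := mul_nonneg silver_pos.le (norm_nonneg z)
  gcongr
  linarith

lemma differentiableOn_phiR : DifferentiableOn ℂ phiR unitDisk := by
  have : phiR = fun z : ℂ => 1 + silver * z * (1 + silver * z) / (1 - silver * z) :=
    funext phiR_eq
  rw [this]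
  intro z hz
  have := one_sub_silver_mul_ne_zero hz
  exact DifferentiableAt.differentiableWithinAt (by fun_prop (disch := assumption))

/-! ### Passing from subordination to a bound on the defect -/

/-- The logarithmic derivative of a function of the class, minus its value at the origin. -/
structure IsStarDefect (f p : ℂ → ℂ) : Prop where
  differentiableOn : DifferentiableOn ℂ p unitDisk
  map_zero : p 0 = 0
  norm_le : ∀ z ∈ unitDisk, ‖p z‖ ≤ majorant (silver * ‖z‖)
  mul_deriv : ∀ z ∈ unitDisk, z * deriv f z = f z * (1 + p z)

lemma IsStarDefect.norm_le_one {f p : ℂ → ℂ} (h : IsStarDefect f p) {z : ℂ}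
    (hz : z ∈ unitDisk) : ‖p z‖ ≤ 1 :=
  (h.norm_le z hz).trans (majorant_le_one (norm_nonneg z) (mem_unitDisk.1 hz).le)

lemma IsNormalizedUnivalent.ne_zero {f : ℂ → ℂ} (hf : IsNormalizedUnivalent f) {z : ℂ}
    (hz : z ∈ unitDisk) (h0 : z ≠ 0) : f z ≠ 0 := fun h =>
  h0 (hf.injective hz zero_mem_unitDisk (h.trans hf.map_zero.symm))

lemma IsNormalizedUnivalent.mul_deriv {f : ℂ → ℂ} (hf : IsNormalizedUnivalent f) {z : ℂ}
    (hz : z ∈ unitDisk) : z * deriv f z = f z * starQuotient f z := by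
  by_cases h0 : z = 0
  · simp [h0, hf.map_zero]
  · rw [starQuotient, if_neg h0, mul_div_cancel₀ _ (hf.ne_zero hz h0)]

lemma exists_isStarDefect {f : ℂ → ℂ} (hf : f ∈ starlikeClassR) : ∃ p, IsStarDefect f p := by
  obtain ⟨hu, ω, hd, hm, h0, he⟩ := hf
  refine ⟨fun z => phiR (ω z) - 1, (differentiableOn_phiR.comp hd hm).sub_const 1, ?_, ?_, ?_⟩
  · simp [h0, phiR]
  · intro z hz
    refine (norm_phiR_sub_one_le (hm hz)).trans ?_
    -- Schwarz lemma.
    have hs : ‖ω z‖ ≤ ‖z‖ :=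
      Complex.norm_le_norm_of_mapsTo_ball hd (hm.mono_right Metric.ball_subset_closedBall) h0
        (mem_unitDisk.1 hz)
    exact majorant_mono (mul_nonneg silver_pos.le (norm_nonneg _))
      (mul_le_mul_of_nonneg_left hs silver_pos.le)
      (by linarith [silver_mul_lt_half (mem_unitDisk.1 hz).le])
  · intro z hz
    rw [hu.mul_deriv hz, he z hz]
    ring

/-! ### Coefficient estimate -/

lemma analyticAt_zero {f : ℂ → ℂ} (hf : DifferentiableOn ℂ f unitDisk) : AnalyticAt ℂ f 0 :=
  hf.analyticAt (isOpen_unitDisk.mem_nhds zero_mem_unitDisk)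

lemma norm_taylorCoeff_le_one {p : ℂ → ℂ} (hd : DifferentiableOn ℂ p unitDisk)
    (hp : ∀ z ∈ unitDisk, ‖p z‖ ≤ 1) (n : ℕ) : ‖taylorCoeff p n‖ ≤ 1 := by
  -- Cauchy's estimate on circles of radius `R < 1`, followed by `R → 1`.
  have key : ∀ R : ℝ, 0 < R → R < 1 → ‖taylorCoeff p n‖ * R ^ n ≤ 1 := by
    intro R hR hR1
    have hsub : Metric.closedBall (0 : ℂ) R ⊆ unitDisk := Metric.closedBall_subset_ball hR1
    have h := Complex.norm_iteratedDeriv_le_of_forall_mem_sphere_norm_le (c := 0) (C := 1) n hR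
      (hd.diffContOnCl_ball hsub)
      (fun z hz => hp z (hsub (Metric.sphere_subset_closedBall hz)))
    rw [taylorCoeff, norm_div, Complex.norm_natCast]
    have hn : (0 : ℝ) < n.factorial := by exact_mod_cast n.factorial_pos
    rw [le_div_iff₀ (by positivity)] at h
    rw [div_mul_eq_mul_div, div_le_one hn]
    linarith
  have ht : Tendsto (fun R : ℝ => ‖taylorCoeff p n‖ * R ^ n) (𝓝[<] 1) (𝓝 (‖taylorCoeff p n‖ * 1 ^ n)) :=
    (Continuous.tendsto (by fun_prop) 1).mono_left nhdsWithin_le_nhds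
  rw [one_pow, mul_one] at ht
  refine le_of_tendsto ht ?_
  filter_upwards [Ioo_mem_nhdsLT (zero_lt_one : (0 : ℝ) < 1)] with R hR using key R hR.1 hR.2

lemma taylorCoeff_mul {f g : ℂ → ℂ} (hf : AnalyticAt ℂ f 0) (hg : AnalyticAt ℂ g 0) (n : ℕ) :
    taylorCoeff (f * g) n =
      ∑ i ∈ Finset.range (n + 1), taylorCoeff f i * taylorCoeff g (n - i) := by
  rw [taylorCoeff, iteratedDeriv_mul hf.contDiffAt hg.contDiffAt, Finset.sum_div]
  refine Finset.sum_congr rfl fun i hi => ?_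
  have hi' : i ≤ n := Nat.lt_succ_iff.1 (Finset.mem_range.1 hi)
  have h := Nat.choose_mul_factorial_mul_factorial hi'
  have h' : (n.choose i : ℂ) * i.factorial * (n - i).factorial = n.factorial := by exact_mod_cast h
  have h1 : (i.factorial : ℂ) ≠ 0 := by exact_mod_cast i.factorial_ne_zero
  have h2 : ((n - i).factorial : ℂ) ≠ 0 := by exact_mod_cast (n - i).factorial_ne_zero
  have h3 : (n.factorial : ℂ) ≠ 0 := by exact_mod_cast n.factorial_ne_zero
  rw [taylorCoeff, taylorCoeff, div_mul_div_comm, div_eq_div_iff h3 (mul_ne_zero h1 h2), ← h']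
  ring

lemma taylorCoeff_id_mul_deriv {f : ℂ → ℂ} (hf : AnalyticAt ℂ f 0) (n : ℕ) :
    taylorCoeff (id * deriv f) n = n * taylorCoeff f n := by
  rw [taylorCoeff_mul analyticAt_id hf.deriv]
  have hid : ∀ i, taylorCoeff id i = if i = 1 then 1 else 0 := by
    intro i
    rw [taylorCoeff, iteratedDeriv_id]
    by_cases h0 : i = 0
    · simp [h0]
    · by_cases h1 : i = 1 <;> simp [h0, h1]
  simp only [hid, ite_mul, one_mul, zero_mul, Finset.sum_ite_eq', Finset.mem_range]
  cases n with
  | zero => simp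
  | succ n =>
    have : ((n : ℂ) + 1) ≠ 0 := by exact_mod_cast n.succ_ne_zero
    rw [if_pos (by omega), taylorCoeff, taylorCoeff, ← iteratedDeriv_succ', Nat.add_sub_cancel,
      Nat.factorial_succ]
    push_cast
    field_simp

/-- Comparing coefficients in `z f' = f + f p` gives `(n - 1) a_n = ∑ a_i p_(n - i)` over `1 ≤ i ≤ n
- 1`. These are `n - 1` terms of modulus at most `1`, by induction. -/
lemma norm_taylorCoeff_le_of_isStarDefect {f p : ℂ → ℂ} (hf : IsNormalizedUnivalent f)
    (hp : IsStarDefect f p) (n : ℕ) : ‖taylorCoeff f n‖ ≤ 1 := by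
  have haf := analyticAt_zero hf.analytic
  have hap := analyticAt_zero hp.differentiableOn
  have hrec : ∀ n : ℕ, (n : ℂ) * taylorCoeff f n = taylorCoeff f n +
      ∑ i ∈ Finset.range (n + 1), taylorCoeff f i * taylorCoeff p (n - i) := by
    intro n
    rw [← taylorCoeff_id_mul_deriv haf, ← taylorCoeff_mul haf hap]
    have he : (id * deriv f) =ᶠ[𝓝 0] f + f * p := by
      filter_upwards [isOpen_unitDisk.mem_nhds zero_mem_unitDisk] with z hz
      simp only [Pi.mul_apply, Pi.add_apply, id]
      rw [hp.mul_deriv z hz]; ring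
    rw [taylorCoeff, he.iteratedDeriv_eq, iteratedDeriv_add haf.contDiffAt
      (haf.mul hap).contDiffAt, add_div]
    rfl
  have hf0 : taylorCoeff f 0 = 0 := by simp [taylorCoeff, hf.map_zero]
  have hp0 : taylorCoeff p 0 = 0 := by simp [taylorCoeff, hp.map_zero]
  have hpn := norm_taylorCoeff_le_one hp.differentiableOn fun z hz => hp.norm_le_one hz
  induction n using Nat.strong_induction_on with
  | _ n ih =>
    match n with
    | 0 => simp [hf0]
    | 1 => simp [taylorCoeff, hf.deriv_zero]
    | m + 2 =>
      have h := hrec (m + 2)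
      -- The two end terms vanish because `p 0 = 0` and `f 0 = 0`.
      rw [Finset.sum_range_succ, Nat.sub_self, hp0, mul_zero, add_zero, Finset.sum_range_succ',
        hf0, zero_mul, add_zero] at h
      have h2 : ((m : ℂ) + 1) * taylorCoeff f (m + 2) = ∑ i ∈ Finset.range (m + 1),
          taylorCoeff f (i + 1) * taylorCoeff p (m + 2 - (i + 1)) := by
        rw [Nat.cast_add m 2, Nat.cast_ofNat] at h
        linear_combination h
      have h3 : ‖((m : ℂ) + 1) * taylorCoeff f (m + 2)‖ ≤ (m + 1 : ℝ) := by
        rw [h2]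
        refine (norm_sum_le_of_le _ (f := _) (n := fun _ => (1 : ℝ)) fun i hi => ?_).trans (by simp)
        rw [norm_mul]
        exact mul_le_one₀ (ih _ (by have := Finset.mem_range.1 hi; omega)) (norm_nonneg _) (hpn _)
      have h4 : ‖(m : ℂ) + 1‖ = m + 1 := by
        have := Complex.norm_natCast (m + 1); push_cast at this; exact this
      rw [norm_mul, h4] at h3
      have : (0 : ℝ) < m + 1 := by positivity
      exact le_of_mul_le_mul_left (by linarith) this

/-! ### Growth estimate -/

/-- `(1 + x + x ^ 2 / 2) (1 - x) ^ 2 = 1 - (x ^ 2 + 2 x) / 2 + x ^ 4 / 2`, and `x ^ 2 + 2 x ≤ 1` up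
to `silver`. -/
lemma half_le_exp_mul_sq {x : ℝ} (h0 : 0 ≤ x) (h1 : x ≤ silver) :
    1 / 2 ≤ Real.exp x * (1 - x) ^ 2 := by
  have h2 := Real.quadratic_le_exp_of_nonneg h0
  have h3 : x ^ 2 + 2 * x ≤ 1 := by nlinarith [silver_sq_add, silver_pos]
  have h4 := mul_le_mul_of_nonneg_right h2 (sq_nonneg (1 - x))
  nlinarith [pow_nonneg h0 4]

/-- The weight `e ^ x (1 - x) ^ 2` has logarithmic derivative `-(1 + x) / (1 - x)`, which exactly
offsets the largest growth of `‖q‖` along a ray allowed by `majorant`. Squares keep the norm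
differentiable. -/
lemma antitoneOn_normSq_mul {q : ℂ → ℂ} (hd : DifferentiableOn ℂ q unitDisk)
    (hq : ∀ z ∈ unitDisk, z ≠ 0 → ‖z * deriv q z‖ ≤ ‖q z‖ * majorant (silver * ‖z‖))
    {z : ℂ} (hz : z ∈ unitDisk) (hz0 : z ≠ 0) :
    AntitoneOn (fun t : ℝ => ‖q (t * z)‖ ^ 2 *
      (Real.exp (silver * ‖z‖ * t) * (1 - silver * ‖z‖ * t) ^ 2) ^ 2) (Icc 0 1) := by
  set s := silver * ‖z‖ with hs
  have hs0 : 0 < s := mul_pos silver_pos (norm_pos_iff.2 hz0)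
  have hs1 : s < 1 / 2 := silver_mul_lt_half (mem_unitDisk.1 hz).le
  have hmem : ∀ t ∈ Icc (0 : ℝ) 1, (t : ℂ) * z ∈ unitDisk := by
    intro t ht
    rw [mem_unitDisk, norm_mul, Complex.norm_real, Real.norm_of_nonneg ht.1]
    exact (mul_le_of_le_one_left (norm_nonneg z) ht.2).trans_lt (mem_unitDisk.1 hz)
  have hderiv : ∀ t ∈ Icc (0 : ℝ) 1, HasDerivAt (fun t : ℝ => ‖q (t * z)‖ ^ 2 *
      (Real.exp (s * t) * (1 - s * t) ^ 2) ^ 2)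
      (2 * inner ℝ (q (t * z)) (deriv q (t * z) * z) *
        (Real.exp (s * t) * (1 - s * t) ^ 2) ^ 2 + ‖q (t * z)‖ ^ 2 *
        (2 * (Real.exp (s * t) * (1 - s * t) ^ 2) *
          (-s * Real.exp (s * t) * (1 - (s * t) ^ 2)))) t := by
    intro t ht
    have h1 : HasDerivAt (fun t : ℝ => q (t * z)) (deriv q (t * z) * z) t := by
      have ha : HasDerivAt q (deriv q (t * z)) (t * z) :=
        (hd.differentiableAt (isOpen_unitDisk.mem_nhds (hmem t ht))).hasDerivAt
      have hb : HasDerivAt (fun w : ℂ => w * z) z (t : ℂ) := by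
        simpa using (hasDerivAt_id (t : ℂ)).mul_const z
      exact (ha.comp (t : ℂ) hb).comp_ofReal
    have h2 : HasDerivAt (fun t : ℝ => Real.exp (s * t) * (1 - s * t) ^ 2)
        (-s * Real.exp (s * t) * (1 - (s * t) ^ 2)) t := by
      have ha : HasDerivAt (fun t : ℝ => s * t) s t := by
        simpa using (hasDerivAt_id t).const_mul s
      refine (ha.exp.mul ((ha.const_sub 1).pow 2)).congr_deriv ?_
      simp only [Nat.cast_ofNat, Pi.pow_apply]; ring
    refine (h1.norm_sq.mul (h2.pow 2)).congr_deriv ?_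
    simp only [Nat.cast_ofNat, Pi.pow_apply]; ring
  refine antitoneOn_of_deriv_nonpos (convex_Icc 0 1)
    (fun t ht => (hderiv t ht).continuousAt.continuousWithinAt)
    (fun t ht => (hderiv t (interior_subset ht)).differentiableAt.differentiableWithinAt) ?_
  intro t ht
  have htm := interior_subset ht
  rw [interior_Icc] at ht
  rw [(hderiv t htm).deriv]
  have htn : ‖(t : ℂ) * z‖ = t * ‖z‖ := by
    rw [norm_mul, Complex.norm_real, Real.norm_of_nonneg htm.1]
  have hx0 : 0 < s * t := mul_pos hs0 ht.1
  have hx1 : s * t < 1 := by nlinarith [ht.2]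
  have h3 := hq _ (hmem t htm) (mul_ne_zero (by exact_mod_cast ht.1.ne') hz0)
  have hst : silver * ‖(t : ℂ) * z‖ = s * t := by rw [htn, hs]; ring
  rw [hst] at h3
  have h4 : ‖deriv q (t * z) * z‖ * (1 - s * t) ≤ ‖q (t * z)‖ * (s * (1 + s * t)) := by
    have : ‖(t : ℂ) * z * deriv q (t * z)‖ = t * ‖deriv q (t * z) * z‖ := by
      rw [mul_assoc, norm_mul, Complex.norm_real, Real.norm_of_nonneg htm.1, mul_comm z]
    rw [this, majorant, mul_div_assoc', le_div_iff₀ (by linarith)] at h3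
    refine le_of_mul_le_mul_left ?_ ht.1
    linarith
  have h5 := real_inner_le_norm (q (t * z)) (deriv q (t * z) * z)
  set Q := ‖q (t * z)‖
  set D := ‖deriv q (t * z) * z‖
  set x := s * t
  have hQ : 0 ≤ Q := norm_nonneg _
  have he : 0 < Real.exp x := Real.exp_pos x
  have h6 : inner ℝ (q (t * z)) (deriv q (t * z) * z) * (1 - x) ≤ Q ^ 2 * (s * (1 + x)) := by
    calc _ ≤ Q * D * (1 - x) := mul_le_mul_of_nonneg_right h5 (by linarith)
      _ = Q * (D * (1 - x)) := by ring
      _ ≤ Q * (Q * (s * (1 + x))) := mul_le_mul_of_nonneg_left h4 hQ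
      _ = _ := by ring
  -- The factor common to both terms of the derivative; what remains is `h6`.
  have h7 : 0 ≤ 2 * Real.exp x ^ 2 * (1 - x) ^ 3 := by
    have : 0 ≤ 1 - x := by linarith
    positivity
  linarith [mul_le_mul_of_nonneg_left h6 h7]

lemma norm_le_two_of_norm_mul_deriv_le {q : ℂ → ℂ} (hd : DifferentiableOn ℂ q unitDisk)
    (h0 : q 0 = 1)
    (hq : ∀ z ∈ unitDisk, z ≠ 0 → ‖z * deriv q z‖ ≤ ‖q z‖ * majorant (silver * ‖z‖))
    {z : ℂ} (hz : z ∈ unitDisk) : ‖q z‖ ≤ 2 := by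
  by_cases hz0 : z = 0
  · simp [hz0, h0]
  have h := antitoneOn_normSq_mul hd hq hz hz0 (left_mem_Icc.2 zero_le_one)
    (right_mem_Icc.2 zero_le_one) zero_le_one
  simp only [Complex.ofReal_one, one_mul, mul_one, Complex.ofReal_zero, zero_mul, h0, norm_one,
    one_pow, mul_zero, Real.exp_zero, sub_zero] at h
  have h1 := half_le_exp_mul_sq (mul_nonneg silver_pos.le (norm_nonneg z))
    (mul_le_of_le_one_right silver_pos.le (mem_unitDisk.1 hz).le)
  rw [← mul_pow] at h
  have h2 := (sq_le_one_iff₀ (mul_nonneg (norm_nonneg _) (by linarith))).1 h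
  nlinarith [norm_nonneg (q z)]

lemma eq_mul_dslope {f : ℂ → ℂ} (hf : IsNormalizedUnivalent f) (z : ℂ) :
    f z = z * dslope f 0 z := by
  have := sub_smul_dslope f 0 z
  rw [hf.map_zero] at this
  simpa using this.symm

lemma differentiableOn_dslope_zero {f : ℂ → ℂ} (hf : IsNormalizedUnivalent f) :
    DifferentiableOn ℂ (dslope f 0) unitDisk :=
  (Complex.differentiableOn_dslope (isOpen_unitDisk.mem_nhds zero_mem_unitDisk)).2 hf.analytic

lemma dslope_zero_ne_zero {f : ℂ → ℂ} (hf : IsNormalizedUnivalent f) {z : ℂ}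
    (hz : z ∈ unitDisk) : dslope f 0 z ≠ 0 := by
  by_cases h0 : z = 0
  · simp [h0, hf.deriv_zero]
  · exact fun h => hf.ne_zero hz h0 (by rw [eq_mul_dslope hf, h, mul_zero])

lemma IsStarDefect.mul_deriv_dslope {f p : ℂ → ℂ} (hp : IsStarDefect f p)
    (hf : IsNormalizedUnivalent f) {z : ℂ} (hz : z ∈ unitDisk) :
    z * deriv (dslope f 0) z = dslope f 0 z * p z := by
  by_cases h0 : z = 0
  · simp [h0, hp.map_zero]
  have hg := ((differentiableOn_dslope_zero hf).differentiableAt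
    (isOpen_unitDisk.mem_nhds hz)).hasDerivAt
  have h1 : deriv f z = dslope f 0 z + z * deriv (dslope f 0) z := by
    have h := (hasDerivAt_id z).mul hg
    have he : f = id * dslope f 0 := funext fun w => eq_mul_dslope hf w
    conv_lhs => rw [he]
    simpa using h.deriv
  have h2 := hp.mul_deriv z hz
  rw [h1, eq_mul_dslope hf z] at h2
  refine mul_left_cancel₀ h0 ?_
  linear_combination h2

lemma norm_dslope_le_two {f p : ℂ → ℂ} (hf : IsNormalizedUnivalent f) (hp : IsStarDefect f p)
    {z : ℂ} (hz : z ∈ unitDisk) : ‖dslope f 0 z‖ ≤ 2 := by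
  refine norm_le_two_of_norm_mul_deriv_le (differentiableOn_dslope_zero hf)
    (by simp [hf.deriv_zero]) (fun w hw _ => ?_) hz
  rw [hp.mul_deriv_dslope hf hw, norm_mul]
  exact mul_le_mul_of_nonneg_left (hp.norm_le w hw) (norm_nonneg _)

/-- The reciprocal of `dslope f 0` satisfies the same equation with `-p` in place of `p`, so the
upper bound `2` applies to it too. -/
lemma half_le_norm_dslope {f p : ℂ → ℂ} (hf : IsNormalizedUnivalent f) (hp : IsStarDefect f p)
    {z : ℂ} (hz : z ∈ unitDisk) : 1 / 2 ≤ ‖dslope f 0 z‖ := by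
  have hd := differentiableOn_dslope_zero hf
  have h : ‖(dslope f 0)⁻¹ z‖ ≤ 2 := by
    refine norm_le_two_of_norm_mul_deriv_le (hd.inv fun w hw => dslope_zero_ne_zero hf hw)
      (by simp [hf.deriv_zero]) (fun w hw _ => ?_) hz
    have hne := dslope_zero_ne_zero hf hw
    have hg := (hd.differentiableAt (isOpen_unitDisk.mem_nhds hw)).hasDerivAt
    have he : w * deriv (dslope f 0)⁻¹ w = -((dslope f 0)⁻¹ w * p w) := by
      rw [(hg.inv hne).deriv, Pi.inv_apply, mul_div_assoc', mul_neg, hp.mul_deriv_dslope hf hw]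
      field_simp
    rw [he, norm_neg, norm_mul]
    exact mul_le_mul_of_nonneg_left (hp.norm_le w hw) (norm_nonneg _)
  have hpos : 0 < ‖dslope f 0 z‖ := norm_pos_iff.2 (dslope_zero_ne_zero hf hz)
  rw [Pi.inv_apply, norm_inv, inv_le_comm₀ hpos two_pos] at h
  linarith

/-! ### Distance to the boundary -/

lemma isOpen_image {f : ℂ → ℂ} (hf : IsNormalizedUnivalent f) : IsOpen (f '' unitDisk) := by
  have ha : AnalyticOnNhd ℂ f unitDisk := hf.analytic.analyticOnNhd isOpen_unitDisk
  rcases ha.is_constant_or_isOpen (convex_ball 0 1).isPreconnected with ⟨w, hw⟩ | h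
  · have hm : (1 / 2 : ℂ) ∈ unitDisk := by rw [mem_unitDisk]; norm_num
    exact absurd ((hw _ hm).trans ((hw 0 zero_mem_unitDisk).symm.trans hf.map_zero))
      (hf.ne_zero hm (by norm_num))
  · exact h _ subset_rfl isOpen_unitDisk

/-- Needed because `Metric.infDist` to the empty set is `0`. The image is bounded, so it is not the
whole plane. -/
lemma frontier_image_nonempty {f p : ℂ → ℂ} (hf : IsNormalizedUnivalent f)
    (hp : IsStarDefect f p) : (frontier (f '' unitDisk)).Nonempty := by
  rw [nonempty_iff_ne_empty, Ne, frontier_eq_empty_iff, not_or]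
  refine ⟨(Nonempty.image f ⟨0, zero_mem_unitDisk⟩).ne_empty, fun h => ?_⟩
  obtain ⟨z, hz, h3⟩ : (3 : ℂ) ∈ f '' unitDisk := h ▸ mem_univ _
  have h1 : ‖f z‖ = 3 := by rw [h3]; norm_num
  rw [eq_mul_dslope hf, norm_mul] at h1
  have h2 := norm_dslope_le_two hf hp hz
  have h4 := mem_unitDisk.1 hz
  nlinarith [norm_nonneg z, norm_nonneg (dslope f 0 z)]

lemma half_le_norm_of_mem_frontier {f p : ℂ → ℂ} (hf : IsNormalizedUnivalent f)
    (hp : IsStarDefect f p) {y : ℂ} (hy : y ∈ frontier (f '' unitDisk)) : 1 / 2 ≤ ‖y‖ := by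
  have hyn : y ∉ f '' unitDisk := fun h => hy.2 ((isOpen_image hf).interior_eq.symm ▸ h)
  have key : ∀ r : ℝ, r < 1 → r * (1 / 2) ≤ ‖y‖ := by
    intro r hr
    have hK : Metric.closedBall (0 : ℂ) r ⊆ unitDisk := Metric.closedBall_subset_ball hr
    -- A closed cover of the image: a compact part inside it, which misses the boundary point, and a
    -- part far from `0`.
    have hc : IsClosed (f '' Metric.closedBall (0 : ℂ) r ∪ {w | r * (1 / 2) ≤ ‖w‖}) :=
      ((isCompact_closedBall 0 r).image_of_continuousOn
        (hf.analytic.continuousOn.mono hK)).isClosed.union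
        (isClosed_le continuous_const continuous_norm)
    have hs : f '' unitDisk ⊆ f '' Metric.closedBall (0 : ℂ) r ∪ {w | r * (1 / 2) ≤ ‖w‖} := by
      rintro _ ⟨z, hz, rfl⟩
      by_cases hzr : ‖z‖ ≤ r
      · exact Or.inl (mem_image_of_mem f (by simpa using hzr))
      · right
        rw [mem_ofPred_eq, eq_mul_dslope hf, norm_mul]
        exact mul_le_mul (not_le.1 hzr).le (half_le_norm_dslope hf hp hz) (by norm_num)
          (norm_nonneg z)
    rcases closure_minimal hs hc hy.1 with h | h
    · exact absurd (image_mono hK h) hyn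
    · exact h
  refine le_of_forall_lt fun c hc => ?_
  by_contra! h
  have := key (c + 1 / 2) (by linarith)
  linarith

lemma bohrInequality_of_mem {f : ℂ → ℂ} (hf : f ∈ starlikeClassR) {r : ℝ} (h0 : 0 ≤ r)
    (h1 : r ≤ 1 / 3) : BohrInequality f r := by
  obtain ⟨p, hp⟩ := exists_isStarDefect hf
  have hu := hf.1
  have hle : ∀ n : ℕ, ‖taylorCoeff f (n + 2)‖ * r ^ (n + 2) ≤ r ^ 2 * r ^ n := fun n => by
    rw [← pow_add, add_comm 2 n]
    exact mul_le_of_le_one_left (pow_nonneg h0 _) (norm_taylorCoeff_le_of_isStarDefect hu hp _)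
  have hg : HasSum (fun n : ℕ => r ^ 2 * r ^ n) (r ^ 2 * (1 - r)⁻¹) :=
    (hasSum_geometric_of_lt_one h0 (by linarith)).mul_left _
  have hs : Summable fun n : ℕ => ‖taylorCoeff f (n + 2)‖ * r ^ (n + 2) :=
    hg.summable.of_nonneg_of_le (fun n => by positivity) hle
  refine ⟨hs, ?_⟩
  have h2 : ∑' n : ℕ, ‖taylorCoeff f (n + 2)‖ * r ^ (n + 2) ≤ r ^ 2 * (1 - r)⁻¹ :=
    hg.tsum_eq ▸ hs.tsum_le_tsum hle hg.summable
  have h3 : r + r ^ 2 * (1 - r)⁻¹ ≤ 1 / 2 := by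
    have : r + r ^ 2 * (1 - r)⁻¹ = r / (1 - r) := by
      have : 1 - r ≠ 0 := by linarith
      field_simp; ring
    rw [this, div_le_iff₀ (by linarith)]
    linarith
  refine le_trans (b := 1 / 2) (by linarith) ((Metric.le_infDist (frontier_image_nonempty hu hp)).2 ?_)
  intro y hy
  rw [hu.map_zero, dist_zero_left]
  exact half_le_norm_of_mem_frontier hu hp hy

/-! ### The extremal function -/

/-- The function `e ^ w (1 - w) ^ 2`; the extremal function is `z / expSq ((√2 - 1) z)`. -/
noncomputable def expSq (w : ℂ) : ℂ := Complex.exp w * (1 - w) ^ 2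

lemma hasDerivAt_expSq (w : ℂ) :
    HasDerivAt expSq (-(Complex.exp w * (1 - w ^ 2))) w := by
  refine ((Complex.hasDerivAt_exp w).mul (((hasDerivAt_id w).const_sub 1).pow 2)).congr_deriv ?_
  simp only [Nat.cast_ofNat, Pi.pow_apply, id]; ring

lemma hasDerivAt_deriv_expSq (w : ℂ) :
    HasDerivAt (fun w => -(Complex.exp w * (1 - w ^ 2)))
      (-(Complex.exp w * (1 - 2 * w - w ^ 2))) w := by
  refine ((Complex.hasDerivAt_exp w).mul
    (((hasDerivAt_id w).pow 2).const_sub 1)).neg.congr_deriv ?_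
  simp only [Nat.cast_ofNat, Pi.pow_apply, id]; ring

lemma expSq_zero : expSq 0 = 1 := by simp [expSq]

lemma expSq_ne_zero {z : ℂ} (hz : z ∈ unitDisk) : expSq (silver * z) ≠ 0 :=
  mul_ne_zero (Complex.exp_ne_zero _) (pow_ne_zero _ (one_sub_silver_mul_ne_zero hz))

/-- Mean value inequality: the second derivative of `expSq` is at most `2 * 2`, since `|e ^ w| ≤ 2`
and `1 + 2 * silver + silver ^ 2 = 2`. -/
lemma norm_deriv_expSq_sub_le {u v : ℂ} (hu : ‖u‖ ≤ silver) (hv : ‖v‖ ≤ silver) :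
    ‖-(Complex.exp v * (1 - v ^ 2)) - -(Complex.exp u * (1 - u ^ 2))‖ ≤ 4 * ‖v - u‖ := by
  refine (convex_closedBall (0 : ℂ) silver).norm_image_sub_le_of_norm_hasDerivWithin_le
    (fun w _ => (hasDerivAt_deriv_expSq w).hasDerivWithinAt) (fun w hw => ?_)
    (by simpa using hu) (by simpa using hv)
  have hw' : ‖w‖ ≤ silver := by simpa using hw
  rw [norm_neg, norm_mul]
  have h1 : ‖Complex.exp w‖ ≤ 2 := by
    rw [Complex.norm_exp]
    have h : w.re ≤ 1 / 2 := (Complex.re_le_norm w).trans (hw'.trans silver_lt_half.le)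
    have h2 : Real.exp (1 / 2) ^ 2 = Real.exp 1 := by rw [← Real.exp_nat_mul]; norm_num
    have h3 := Real.exp_one_lt_d9
    have h4 := Real.exp_le_exp.2 h
    nlinarith [Real.exp_pos (1 / 2)]
  have h2 : ‖1 - 2 * w - w ^ 2‖ ≤ 2 := by
    have ha := norm_sub_le (1 - 2 * w) (w ^ 2)
    have hb := norm_sub_le 1 (2 * w)
    rw [norm_one, norm_mul, RCLike.norm_ofNat] at hb
    rw [norm_pow] at ha
    nlinarith [norm_nonneg w, silver_sq_add]
  calc _ ≤ (2 : ℝ) * 2 := mul_le_mul h1 h2 (norm_nonneg _) (by norm_num)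
    _ = 4 := by norm_num

/-- This carries the injectivity of the extremal function. The path `u * expSq (t v) - v * expSq (t
u)` runs from `u - v` to `0` with speed at most `4 * silver ^ 2 * ‖v - u‖`, and `4 * silver ^ 2 ≤ 4
/ 5 < 1` forces `u = v`. -/
lemma eq_of_mul_expSq_eq {u v : ℂ} (hu : ‖u‖ ≤ silver) (hv : ‖v‖ ≤ silver)
    (h : u * expSq v = v * expSq u) : u = v := by
  have hderiv : ∀ t ∈ Icc (0 : ℝ) 1, HasDerivWithinAt
      (fun t : ℝ => u * expSq (t * v) - v * expSq (t * u))
      (u * (-(Complex.exp (t * v) * (1 - (t * v) ^ 2)) * v) -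
        v * (-(Complex.exp (t * u) * (1 - (t * u) ^ 2)) * u)) (Icc 0 1) t := by
    intro t _
    have hlin : ∀ a : ℂ, HasDerivAt (fun w : ℂ => w * a) a (t : ℂ) := fun a => by
      simpa using (hasDerivAt_id (t : ℂ)).mul_const a
    have hcomp : ∀ a : ℂ, HasDerivAt (fun t : ℝ => expSq (t * a))
        (-(Complex.exp (t * a) * (1 - (t * a) ^ 2)) * a) t := fun a =>
      (HasDerivAt.comp (h₂ := expSq) (t : ℂ) (hasDerivAt_expSq (t * a)) (hlin a)).comp_ofReal
    exact (((hcomp v).const_mul u).sub ((hcomp u).const_mul v)).hasDerivWithinAt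
  have hbound : ∀ t ∈ Ico (0 : ℝ) 1, ‖u * (-(Complex.exp (t * v) * (1 - (t * v) ^ 2)) * v) -
        v * (-(Complex.exp (t * u) * (1 - (t * u) ^ 2)) * u)‖ ≤ ‖u‖ * ‖v‖ * (4 * ‖v - u‖) := by
    intro t ht
    have hsmall : ∀ a : ℂ, ‖a‖ ≤ silver → ‖(t : ℂ) * a‖ ≤ silver := fun a ha => by
      rw [norm_mul, Complex.norm_real, Real.norm_of_nonneg ht.1]
      exact (mul_le_of_le_one_left (norm_nonneg a) ht.2.le).trans ha
    have h1 := norm_deriv_expSq_sub_le (hsmall u hu) (hsmall v hv)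
    have h2 : ‖(t : ℂ) * v - t * u‖ ≤ ‖v - u‖ := by
      rw [← mul_sub, norm_mul, Complex.norm_real, Real.norm_of_nonneg ht.1]
      exact mul_le_of_le_one_left (norm_nonneg _) ht.2.le
    calc _ = ‖u * v * (-(Complex.exp (t * v) * (1 - (t * v) ^ 2)) -
          -(Complex.exp (t * u) * (1 - (t * u) ^ 2)))‖ := by congr 1; ring
      _ ≤ _ := by
        rw [norm_mul, norm_mul]
        exact mul_le_mul_of_nonneg_left (by linarith) (by positivity)
  have hm := norm_image_sub_le_of_norm_deriv_le_segment_01' hderiv hbound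
  simp only [Complex.ofReal_one, one_mul, Complex.ofReal_zero, zero_mul, expSq_zero, mul_one, h,
    sub_self, zero_sub, neg_sub] at hm
  have h3 : ‖u‖ * ‖v‖ ≤ silver * silver :=
    mul_le_mul hu hv (norm_nonneg v) silver_pos.le
  have h4 : silver * silver ≤ 1 / 5 := by nlinarith [silver_sq_add, two_fifths_lt_silver]
  have h5 : ‖v - u‖ = 0 := by nlinarith [norm_nonneg (v - u)]
  exact (sub_eq_zero.1 (norm_eq_zero.1 h5)).symm

/-- The extremal function `z e ^ (-z / k) / (1 - z / k) ^ 2` with `k = √2 + 1`. -/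
noncomputable def extremal (z : ℂ) : ℂ := z / expSq (silver * z)

lemma hasDerivAt_expSq_silver (z : ℂ) : HasDerivAt (fun z : ℂ => expSq (silver * z))
    (-(Complex.exp (silver * z) * (1 - (silver * z) ^ 2)) * silver) z := by
  have h : HasDerivAt (fun w : ℂ => (silver : ℂ) * w) silver z := by
    simpa using (hasDerivAt_id z).const_mul (silver : ℂ)
  exact (hasDerivAt_expSq (silver * z)).comp z h

lemma mul_deriv_expSq_silver {z : ℂ} (hz : z ∈ unitDisk) :
    z * (-(Complex.exp (silver * z) * (1 - (silver * z) ^ 2)) * silver) =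
      -(expSq (silver * z) * (phiR z - 1)) := by
  have h : ∀ x : ℂ, 1 - x ≠ 0 → Complex.exp x * (1 - x ^ 2) * x =
      Complex.exp x * (1 - x) ^ 2 * (1 + x * (1 + x) / (1 - x) - 1) := fun x hx => by
    field_simp
    ring
  rw [phiR_eq, expSq]
  linear_combination -h _ (one_sub_silver_mul_ne_zero hz)

lemma hasDerivAt_extremal {z : ℂ} (hz : z ∈ unitDisk) :
    HasDerivAt extremal (phiR z / expSq (silver * z)) z := by
  have hne := expSq_ne_zero hz
  refine ((hasDerivAt_id z).div (hasDerivAt_expSq_silver z) hne).congr_deriv ?_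
  rw [id, mul_deriv_expSq_silver hz, div_eq_div_iff (pow_ne_zero 2 hne) hne]
  ring

lemma isKoebeOf_extremal : IsKoebeOf phiR extremal := by
  refine ⟨⟨fun z hz => (hasDerivAt_extremal hz).differentiableAt.differentiableWithinAt,
    fun z hz w hw h => ?_, by simp [extremal], ?_⟩, fun z hz => ?_⟩
  · have hle : ∀ a ∈ unitDisk, ‖(silver : ℂ) * a‖ ≤ silver := fun a ha => by
      rw [norm_silver_mul]
      exact mul_le_of_le_one_right silver_pos.le (mem_unitDisk.1 ha).le
    have hs : (silver : ℂ) ≠ 0 := by exact_mod_cast silver_pos.ne'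
    rw [extremal, extremal, div_eq_div_iff (expSq_ne_zero hz) (expSq_ne_zero hw)] at h
    refine mul_left_cancel₀ hs (eq_of_mul_expSq_eq (hle z hz) (hle w hw) ?_)
    rw [mul_assoc, h, mul_assoc]
  · rw [(hasDerivAt_extremal zero_mem_unitDisk).deriv]
    simp [phiR, expSq_zero]
  · rw [starQuotient]
    split_ifs with h0
    · simp [h0, phiR]
    · have := expSq_ne_zero hz
      rw [(hasDerivAt_extremal hz).deriv, extremal, mul_div_assoc',
        div_div_div_cancel_right₀ this, mul_div_cancel_left₀ _ h0]

lemma IsKoebeOf.isStarDefect {h : ℂ → ℂ} (hh : IsKoebeOf phiR h) :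
    IsStarDefect h (fun z => phiR z - 1) where
  differentiableOn := differentiableOn_phiR.sub_const 1
  map_zero := by simp [phiR]
  norm_le _ hz := norm_phiR_sub_one_le hz
  mul_deriv z hz := by rw [hh.1.mul_deriv hz, hh.2 z hz]; ring

/-- The product of `h z / z` and `expSq (silver * z)` has zero derivative, so it keeps its value `1`
at the origin. At `0` itself the equation for `z` times the derivative says nothing, and continuity
of the derivative is used. -/
lemma IsKoebeOf.eq_extremal {h : ℂ → ℂ} (hh : IsKoebeOf phiR h) {z : ℂ} (hz : z ∈ unitDisk) :
    h z = extremal z := by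
  have hg := differentiableOn_dslope_zero hh.1
  have hQ : DifferentiableOn ℂ (fun z => dslope h 0 z * expSq (silver * z)) unitDisk :=
    hg.mul fun w _ => (hasDerivAt_expSq_silver w).differentiableAt.differentiableWithinAt
  have hne : ∀ w ∈ unitDisk, w ≠ 0 →
      deriv (fun z => dslope h 0 z * expSq (silver * z)) w = 0 := by
    intro w hw h0
    have hgw := (hg.differentiableAt (isOpen_unitDisk.mem_nhds hw)).hasDerivAt
    rw [(hgw.fun_mul (hasDerivAt_expSq_silver w)).deriv]
    refine (mul_eq_zero.1 ?_).resolve_left h0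
    linear_combination expSq (silver * w) * hh.isStarDefect.mul_deriv_dslope hh.1 hw +
      dslope h 0 w * mul_deriv_expSq_silver hw
  have hzero : deriv (fun z => dslope h 0 z * expSq (silver * z)) 0 = 0 := by
    have hc := (analyticAt_zero hQ).deriv.continuousAt
    have he : deriv (fun z => dslope h 0 z * expSq (silver * z)) =ᶠ[𝓝[≠] 0] fun _ => 0 := by
      filter_upwards [self_mem_nhdsWithin,
        nhdsWithin_le_nhds (isOpen_unitDisk.mem_nhds zero_mem_unitDisk)] with w hw hw'
      exact hne w hw' hw
    exact ((hc.eventuallyEq_nhds_iff_eventuallyEq_nhdsNE continuousAt_const).1 he).self_of_nhds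
  have hconst := isOpen_unitDisk.is_const_of_deriv_eq_zero (convex_ball (0 : ℂ) 1).isPreconnected
    hQ (fun w hw => by
      by_cases h0 : w = 0
      · rw [h0]; exact hzero
      · exact hne w hw h0) hz zero_mem_unitDisk
  simp only [dslope_same, hh.1.deriv_zero, mul_zero, expSq_zero, mul_one] at hconst
  rw [extremal, eq_div_iff (expSq_ne_zero hz), eq_mul_dslope hh.1, mul_assoc, hconst, mul_one]

/-! ### The smallest root -/

/-- The extremal function on the real axis. -/
noncomputable def extremalReal (r : ℝ) : ℝ := r / (Real.exp (silver * r) * (1 - silver * r) ^ 2)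

lemma extremal_ofReal (r : ℝ) : extremal r = extremalReal r := by
  simp [extremal, extremalReal, expSq]

lemma continuousOn_extremalReal : ContinuousOn extremalReal (Icc (-1) 1) := by
  intro r hr
  have : Real.exp (silver * r) * (1 - silver * r) ^ 2 ≠ 0 :=
    mul_ne_zero (Real.exp_pos _).ne'
      (pow_ne_zero _ (by linarith [silver_mul_lt_half hr.2]))
  exact ContinuousAt.continuousWithinAt
    (ContinuousAt.div (by fun_prop) (by fun_prop) this)

lemma extremalReal_neg_one_le : extremalReal (-1) ≤ -(1 / 2) := by
  have h1 : Real.exp (silver * -1) ≤ 1 :=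
    Real.exp_le_one_iff.2 (by linarith [silver_pos])
  have h2 : (1 - silver * -1) ^ 2 = 2 := by nlinarith [silver_sq_add]
  rw [extremalReal, h2, div_le_iff₀ (by positivity)]
  linarith

lemma neg_one_le_extremalReal_neg_one : -1 ≤ extremalReal (-1) := by
  have h1 := Real.add_one_le_exp (silver * -1)
  have h2 : (1 - silver * -1) ^ 2 = 2 := by nlinarith [silver_sq_add]
  rw [extremalReal, h2, le_div_iff₀ (by positivity)]
  linarith [silver_lt_half]

lemma one_lt_extremalReal_one : 1 < extremalReal 1 := by
  have h1 : Real.exp (silver * 1) < 2 := by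
    rw [mul_one, ← Real.lt_log_iff_exp_lt two_pos]
    linarith [silver_lt_half, Real.log_two_gt_d9]
  have h2 : (1 - silver * 1) ^ 2 < 2 / 5 := by nlinarith [silver_sq_add, two_fifths_lt_silver]
  have h3 : 0 < 1 - silver * 1 := by linarith [silver_lt_half]
  rw [extremalReal, one_lt_div (by positivity)]
  nlinarith [Real.exp_pos (silver * 1)]

lemma extremalReal_lt_half {r : ℝ} (h0 : 0 < r) (h1 : r ≤ 1 / 3) : extremalReal r < 1 / 2 := by
  have h2 := Real.one_le_exp (mul_pos silver_pos h0).le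
  have hs : silver < 5 / 12 := by nlinarith [silver_sq_add, silver_pos]
  have h3 : silver * r ≤ 5 / 36 := by nlinarith [silver_pos]
  -- Here `(31 / 36) ^ 2 > 2 / 3`, so half of it exceeds `1 / 3 ≥ r`.
  have h4 : (31 / 36) ^ 2 ≤ (1 - silver * r) ^ 2 := by nlinarith
  have h5 : (31 / 36) ^ 2 ≤ Real.exp (silver * r) * (1 - silver * r) ^ 2 := by nlinarith
  rw [extremalReal, div_lt_iff₀ (by linarith)]
  linarith

lemma exists_isSmallestRoot {h : ℂ → ℂ} (hh : IsKoebeOf phiR h) :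
    ∃ rf : ℝ, IsSmallestRoot h rf ∧ 1 / 3 < rf := by
  have hh' : ∀ r : ℝ, |r| < 1 → h r = extremalReal r := fun r hr => by
    rw [hh.eq_extremal (by simpa [mem_unitDisk] using hr), extremal_ofReal]
  have hl1 := extremalReal_neg_one_le
  have hl2 := neg_one_le_extremalReal_neg_one
  have hlim : Tendsto (fun r : ℝ => h (-(r : ℂ))) (𝓝[<] 1) (𝓝 (extremalReal (-1) : ℂ)) := by
    have h1 : Tendsto (fun r : ℝ => -r) (𝓝[<] 1) (𝓝[Icc (-1) 1] (-1)) := by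
      refine tendsto_nhdsWithin_iff.2
        ⟨(continuous_neg.tendsto 1).mono_left nhdsWithin_le_nhds, ?_⟩
      filter_upwards [Ioo_mem_nhdsLT (zero_lt_one : (0 : ℝ) < 1)] with r hr
      constructor <;> linarith [hr.1, hr.2]
    have h2 := (continuousOn_extremalReal (-1) (by norm_num)).tendsto.comp h1
    refine ((Complex.continuous_ofReal.tendsto _).comp h2).congr' ?_
    filter_upwards [Ioo_mem_nhdsLT (zero_lt_one : (0 : ℝ) < 1)] with r hr
    have := hh' (-r) (by rw [abs_neg, abs_of_pos hr.1]; exact hr.2)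
    simpa using this.symm
  have hroot : ∀ r : ℝ, 0 < r → r < 1 →
      (h r + (extremalReal (-1) : ℂ) = 0 ↔ extremalReal r = -extremalReal (-1)) := by
    intro r h0 h1
    rw [hh' r (by rwa [abs_of_pos h0]), ← Complex.ofReal_add, Complex.ofReal_eq_zero,
      add_eq_zero_iff_eq_neg]
  have hcont : ContinuousOn extremalReal (Icc (1 / 3) 1) :=
    continuousOn_extremalReal.mono (Icc_subset_Icc_left (by norm_num))
  have hthird := extremalReal_lt_half (r := 1 / 3) (by norm_num) le_rfl
  have hone := one_lt_extremalReal_one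
  -- On the closed interval the solution set is compact, so a least solution exists; the endpoint
  -- values then exclude `1 / 3` and `1`.
  have hcompact : IsCompact (Icc (1 / 3 : ℝ) 1 ∩ extremalReal ⁻¹' {-extremalReal (-1)}) :=
    isCompact_Icc.of_isClosed_subset
      (hcont.preimage_isClosed_of_isClosed isClosed_Icc isClosed_singleton) inter_subset_left
  have hne : (Icc (1 / 3 : ℝ) 1 ∩ extremalReal ⁻¹' {-extremalReal (-1)}).Nonempty := by
    obtain ⟨r, hr, he⟩ := intermediate_value_Icc (by norm_num) hcont
      (show -extremalReal (-1) ∈ Icc _ _ from ⟨by linarith, by linarith⟩)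
    exact ⟨r, hr, he⟩
  obtain ⟨rf, ⟨hrf, he⟩, hmin⟩ := hcompact.exists_isLeast hne
  rw [mem_preimage, mem_singleton_iff] at he
  have h3 : 1 / 3 < rf := lt_of_le_of_ne hrf.1 fun h => by rw [← h] at he; linarith
  have h4 : rf < 1 := lt_of_le_of_ne hrf.2 fun h => by rw [h] at he; linarith
  refine ⟨rf, ⟨_, hlim, ⟨by linarith, h4, (hroot rf (by linarith) h4).2 he⟩, ?_⟩, h3⟩
  rintro r ⟨hr0, hr1, hr⟩
  rw [hroot r hr0 hr1] at hr
  refine hmin ⟨⟨?_, hr1.le⟩, hr⟩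
  by_contra! hlt
  linarith [extremalReal_lt_half hr0 hlt.le]

end Bohr

theorem corollary2p6 :
    (∀ f ∈ Bohr.starlikeClassR, ∀ z : ℂ, ‖z‖ ≤ 1 / 3 → Bohr.BohrInequality f ‖z‖) ∧
    (∃ h : ℂ → ℂ, Bohr.IsKoebeOf Bohr.phiR h) ∧
    (∀ h : ℂ → ℂ, Bohr.IsKoebeOf Bohr.phiR h →
      ∃ rf : ℝ, Bohr.IsSmallestRoot h rf ∧ 1 / 3 < rf) :=
  ⟨fun _ hf _ hz => Bohr.bohrInequality_of_mem hf (norm_nonneg _) hz,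
    ⟨Bohr.extremal, Bohr.isKoebeOf_extremal⟩, fun _ hh => Bohr.exists_isSmallestRoot hh⟩
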